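/- Let $n\ge 1$, $\alpha\in(0,1)$ and $\mu_{n,\alpha}=2^{\alpha}\pi^{-n/2}\,\Gamma\big(\tfrac{n+\alpha+1}{2}\big)/\Gamma\big(\tfrac{1-\alpha}{2}\big)$. For $g\colon\mathbb{R}^n\to\mathbb{R}$ and $\varphi\colon\mathbb{R}^n\to\mathbb{R}^n$ sufficiently regular put $$\nabla^\alpha g(x)=\mu_{n,\alpha}\int_{\mathbb{R}^n}\frac{(y-x)\,(g(y)-g(x))}{|y-x|^{n+\alpha+1}}\,dy,\qquad \operatorname{div}^\alpha\varphi(x)=\mu_{n,\alpha}\int_{\mathbb{R}^n}\frac{(y-x)\cdot(\varphi(y)-\varphi(x))}{|y-x|^{n+\alpha+1}}\,dy,$$ and $$\nabla^\alpha_{\rm NL}(f,g)(x)=\mu_{n,\alpha}\int_{\mathbb{R}^n}\frac{(y-x)\,(f(y)-f(x))\,(g(y)-g(x))}{|y-x|^{n+\alpha+1}}\,dy.$$ For $p\in[1,\infty]$, let $BV^{\alpha,p}(\mathbb{R}^n)$ be the set of all $f\in L^p(\mathbb{R}^n)$ such that $$\sup\Big\{\int_{\mathbb{R}^n} f\operatorname{div}^\alpha\varphi\,dx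 \;:\; \varphi\in C^\infty_c(\mathbb{R}^n;\mathbb{R}^n),\ \|\varphi\|_{L^\infty}\le 1\Big\}<\infty,$$ and for such $f$ let $D^\alpha f$ be the (unique) finite $\mathbb{R}^n$-valued Radon measure on $\mathbb{R}^n$ with $\int f\operatorname{div}^\alpha\varphi\,dx=-\int\varphi\cdot dD^\alpha f$ for all $\varphi\in C_c^\infty(\mathbb{R}^n;\mathbb{R}^n)$. Let $p\in[1,\infty]$, let $f\in BV^{\alpha,p}(\mathbb{R}^n)$ and let $\eta\colon\mathbb{R}^n\to\mathbb{R}$ be Lipschitz with compact support. Then $f\eta\in BV^{\alpha,q}(\mathbb{R}^n)$ for all $q\in[1,p]$. Moreover, the measures $D^\alpha f$ and $D^\alpha(f\eta)$ exist, $\eta$ is integrable with respect to $D^\alpha f$, the integral defining $\nabla^\alpha\eta(x)$ converges absolutely for every $x$ and the one defining $\nabla^\alpha_{\rm NL}(f,\eta)(x)$ for almost every $x$, the functions $f\,\nabla^\alpha\eta$ and $\nabla^\alpha_{\rm NL}(f,\eta)$ belong to $L^1(\mathbb{R}^n;\mathbb{R}^n)$, and $$D^\alpha(f\eta)=\eta\,D^\alpha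 f+f\,\nabla^\alpha\eta\,\mathcal{L}^n+\nabla^\alpha_{\rm NL}(f,\eta)\,\mathcal{L}^n$$ as finite $\mathbb{R}^n$-valued measures on $\mathbb{R}^n$. -/

import Mathlib

open MeasureTheory
open scoped ContDiff

noncomputable section

namespace FracBV

/-- The Euclidean space `ℝⁿ`. -/
abbrev Rn (n : ℕ) : Type := EuclideanSpace ℝ (Fin n)

/-- The renormalizing constant
`μ_{n,α} = 2^α π^{-n/2} Γ((n+α+1)/2) / Γ((1-α)/2)`. -/
def fracConst (n : ℕ) (α : ℝ) : ℝ :=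
  (2 : ℝ) ^ α * Real.pi ^ (-(n : ℝ) / 2) *
    (Real.Gamma (((n : ℝ) + α + 1) / 2) / Real.Gamma ((1 - α) / 2))

variable {n : ℕ}

/-- The integrand `y ↦ (y - x) (g y - g x) / |y - x|^{n+α+1}` of the fractional gradient at `x`. -/
def fracGradKernel (α : ℝ) (g : Rn n → ℝ) (x y : Rn n) : Rn n :=
  ((g y - g x) / ‖y - x‖ ^ ((n : ℝ) + α + 1)) • (y - x)

/-- The fractional `α`-gradient
`∇^α g (x) = μ_{n,α} ∫ (y - x) (g y - g x) / |y - x|^{n+α+1} dy`. -/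
def fracGrad (α : ℝ) (g : Rn n → ℝ) (x : Rn n) : Rn n :=
  fracConst n α • ∫ y, fracGradKernel α g x y

/-- The fractional `α`-divergence
`div^α φ (x) = μ_{n,α} ∫ (y - x) · (φ y - φ x) / |y - x|^{n+α+1} dy`. -/
def fracDiv (α : ℝ) (φ : Rn n → Rn n) (x : Rn n) : ℝ :=
  fracConst n α * ∫ y, inner ℝ (y - x) (φ y - φ x) / ‖y - x‖ ^ ((n : ℝ) + α + 1)

/-- The integrand `y ↦ (y - x) (f y - f x) (g y - g x) / |y - x|^{n+α+1}` of the non-local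
fractional gradient at `x`. -/
def fracGradNLKernel (α : ℝ) (f g : Rn n → ℝ) (x y : Rn n) : Rn n :=
  ((f y - f x) * (g y - g x) / ‖y - x‖ ^ ((n : ℝ) + α + 1)) • (y - x)

/-- The non-local fractional `α`-gradient
`∇^α_NL (f, g) (x) = μ_{n,α} ∫ (y - x) (f y - f x) (g y - g x) / |y - x|^{n+α+1} dy`. -/
def fracGradNL (α : ℝ) (f g : Rn n → ℝ) (x : Rn n) : Rn n :=
  fracConst n α • ∫ y, fracGradNLKernel α f g x y

/-- `φ ∈ C_c^∞(ℝⁿ; ℝⁿ)`. -/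
def IsTestField (φ : Rn n → Rn n) : Prop :=
  ContDiff ℝ ∞ φ ∧ HasCompactSupport φ

/-- The total fractional variation `|D^α f|(ℝⁿ)`, as a supremum in the extended reals:
`sup {∫ f div^α φ dx : φ ∈ C_c^∞(ℝⁿ; ℝⁿ), ‖φ‖_∞ ≤ 1}`. -/
def totalFracVariation (α : ℝ) (f : Rn n → ℝ) : EReal :=
  ⨆ (φ : Rn n → Rn n) (_ : IsTestField φ ∧ ∀ x, ‖φ x‖ ≤ 1),
    ((∫ x, f x * fracDiv α φ x : ℝ) : EReal)

/-- `f ∈ BV^{α,p}(ℝⁿ)`: `f ∈ L^p(ℝⁿ)` with finite total fractional variation. -/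
def MemBV (α : ℝ) (p : ENNReal) (f : Rn n → ℝ) : Prop :=
  MemLp f p volume ∧ totalFracVariation α f < ⊤

/-- `μ` is a finite `ℝⁿ`-valued Borel measure on `ℝⁿ` such that
`∫ f div^α φ dx = - ∫ φ · dμ` for all `φ ∈ C_c^∞(ℝⁿ; ℝⁿ)`. There is at most one such `μ`. -/
def IsFracVariationMeasure (α : ℝ) (f : Rn n → ℝ) (μ : VectorMeasure (Rn n) (Rn n)) : Prop :=
  μ.variation Set.univ < ⊤ ∧
    ∀ φ : Rn n → Rn n, IsTestField φ →
      ∫ x, f x * fracDiv α φ x = - μ.integral φ (innerSL ℝ)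

open Classical in
/-- The fractional variation measure `D^α f`: the finite `ℝⁿ`-valued measure representing the
fractional variation of `f` (and `0` if there is none). -/
def fracVariation (α : ℝ) (f : Rn n → ℝ) : VectorMeasure (Rn n) (Rn n) :=
  if h : ∃ μ, IsFracVariationMeasure α f μ then h.choose else 0

end FracBV

end

/-! Let `K(x, y)` be the integrand of `∇^α η(x)`; it is symmetric in `x` and `y`. For a test field
`φ`, the splitting `η(y)φ(y) - η(x)φ(x) = η(x)(φ(y) - φ(x)) + (η(y) - η(x))φ(y)` turns `∫ f
div^α(ηφ)` into `∫ fη div^α φ` plus `μ_{n,α} ∬ f(x) φ(y)·K`. Exchanging the variables and writing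
`f(y) = f(x) + (f(y) - f(x))` splits the double integral into the terms of `f ∇^α η` and `∇^α_NL(f,
η)`, both tested against `φ`. Since the left side equals `-∫ ηφ·dD^α f`, this is the Leibniz rule.

Three points need work. Fubini and the exchange need absolute integrability over pairs:
`IsLipBump.quotient_le` bounds the kernel of a Lipschitz bump by a weight decaying in `x`, and this
weight makes `f` integrable for every `p ≥ 1` (`integrable_mul_decay`). The field `ηφ` is only
Lipschitz, so the defining identity of `D^α f` is extended by mollification
(`IsFracVariationMeasure.integral_lipBump`). Finally `D^α f` must exist and be unique: existence is
Hahn–Banach followed by Riesz–Markov in each coordinate (`exists_measures_of_bounded_functional`),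
and uniqueness is the fundamental lemma of the calculus of variations. Vector measures are handled
through densities `m.withDensityᵥ h`, so that integrals against them become Bochner integrals. -/

noncomputable section

/-! ### Kernel estimates for Lipschitz bumps -/

namespace FracBV

variable {n : ℕ} {E : Type*} [NormedAddCommGroup E]

/-- A function with Lipschitz constant `L`, bounded by `M` and vanishing outside the closed ball of
radius `R` around the origin. -/
structure IsLipBump (L M R : ℝ) (g : Rn n → E) : Prop where
  lip : ∀ x y, ‖g y - g x‖ ≤ L * ‖y - x‖
  bound : ∀ x, ‖g x‖ ≤ M
  eq_zero : ∀ x, R < ‖x‖ → g x = 0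

/-- The polynomially decaying weight `(1 + |x|)^{-(n+α)}`. -/
def decay (n : ℕ) (α : ℝ) (x : Rn n) : ℝ := (1 + ‖x‖) ^ (-((n : ℝ) + α))

/-- The integrable kernel `min (1, |z|) |z|^{-(n+α)}`. -/
def truncKernel (n : ℕ) (α : ℝ) (z : Rn n) : ℝ := min 1 ‖z‖ * ‖z‖ ^ (-((n : ℝ) + α))

/-- The weight on pairs of points dominating the difference quotients of Lipschitz bumps. -/
def pairWeight (n : ℕ) (α R : ℝ) (x y : Rn n) : ℝ :=
  truncKernel n α (y - x) + (Metric.closedBall (0 : Rn n) R).indicator 1 y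

theorem decay_pos (α : ℝ) (x : Rn n) : 0 < decay n α x := by
  unfold decay; positivity

theorem decay_le_one {α : ℝ} (hα : 0 ≤ α) (x : Rn n) : decay n α x ≤ 1 :=
  Real.rpow_le_one_of_one_le_of_nonpos (by linarith [norm_nonneg x]) (by
    have : (0 : ℝ) ≤ n := n.cast_nonneg
    linarith)

theorem continuous_decay (α : ℝ) : Continuous (decay n α) := by
  unfold decay
  exact (continuous_const.add continuous_norm).rpow_const fun x =>
    Or.inl (by positivity : 0 < 1 + ‖x‖).ne'

theorem integrable_decay {α : ℝ} (hα : 0 < α) : Integrable (decay n α) :=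
  integrable_one_add_norm (by simpa using hα)

theorem truncKernel_nonneg (α : ℝ) (z : Rn n) : 0 ≤ truncKernel n α z := by
  unfold truncKernel; positivity

/-- In polar coordinates the radial integrand is `r^(-α)` on `(0, 1]` and `r^(-1-α)` beyond, so both
bounds on `α` matter. -/
theorem integrable_truncKernel (hn : 1 ≤ n) {α : ℝ} (hα : α ∈ Set.Ioo (0 : ℝ) 1) :
    Integrable (truncKernel n α) := by
  have : Nontrivial (Rn n) := by
    have : Nonempty (Fin n) := ⟨⟨0, hn⟩⟩
    infer_instance
  have key := integrable_fun_norm_addHaar (volume : Measure (Rn n))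
    (f := fun r : ℝ => min 1 r * r ^ (-((n : ℝ) + α)))
  refine key.2 ?_
  rw [← Set.Ioc_union_Ioi_eq_Ioi (zero_le_one (α := ℝ)), integrableOn_union]
  simp only [finrank_euclideanSpace, Fintype.card_fin, smul_eq_mul]
  have hpow : ∀ r : ℝ, 0 < r → r ^ (n - 1) = r ^ ((n : ℝ) - 1) := fun r hr => by
    rw [← Real.rpow_natCast, Nat.cast_sub hn, Nat.cast_one]
  constructor
  · have h : IntegrableOn (fun r : ℝ => r ^ (-α)) (Set.Ioc 0 1) := by
      rw [← intervalIntegrable_iff_integrableOn_Ioc_of_le zero_le_one]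
      exact intervalIntegral.intervalIntegrable_rpow' (by linarith [hα.2])
    refine h.congr_fun (fun r hr => ?_) measurableSet_Ioc
    simp only
    rw [min_eq_right hr.2, hpow r hr.1]
    nth_rw 3 [← Real.rpow_one r]
    rw [← Real.rpow_add hr.1, ← Real.rpow_add hr.1]
    congr 1; ring
  · refine (integrableOn_Ioi_rpow_of_lt (a := -1 - α) (by linarith [hα.1]) one_pos).congr_fun
      (fun r hr => ?_) measurableSet_Ioi
    have hr0 : (0 : ℝ) < r := one_pos.trans hr
    simp only
    rw [min_eq_left (le_of_lt hr), hpow r hr0, one_mul, ← Real.rpow_add hr0]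
    congr 1; ring

theorem pairWeight_nonneg (α R : ℝ) (x y : Rn n) : 0 ≤ pairWeight n α R x y :=
  add_nonneg (truncKernel_nonneg _ _) (Set.indicator_nonneg (fun _ _ => zero_le_one) _)

/-- The constant in `IsLipBump.quotient_le`. -/
def bumpConst (n : ℕ) (α L M R : ℝ) : ℝ :=
  (L + 2 * M) * (2 * R + 2) ^ ((n : ℝ) + α) + M * 2 ^ ((n : ℝ) + α)

/-- For `x` near the support the decay factor is bounded below, and the Lipschitz and sup bounds
produce `truncKernel`. For `x` far away `g x = 0`, so only `y` in the ball contributes, and there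
`‖y - x‖` is at least a multiple of `1 + ‖x‖`. -/
theorem IsLipBump.quotient_le {α L M R : ℝ} (hα : 0 < α) (hL : 0 ≤ L) (hR : 0 ≤ R) {g : Rn n → E}
    (hg : IsLipBump L M R g) (x y : Rn n) :
    ‖g y - g x‖ * ‖y - x‖ ^ (-((n : ℝ) + α)) ≤
      bumpConst n α L M R * (decay n α x * pairWeight n α R x y) := by
  have hM : 0 ≤ M := (norm_nonneg _).trans (hg.bound 0)
  have hd : 0 < (n : ℝ) + α := by positivity
  set d := (n : ℝ) + α
  have hW := decay_pos α x
  have hG := pairWeight_nonneg α R x y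
  have hWG : 0 ≤ decay n α x * pairWeight n α R x y := by positivity
  unfold bumpConst
  rw [add_mul]
  -- Beyond the threshold `2R + 1` one has `‖x‖ - R ≥ (1 + ‖x‖)/2`.
  rcases le_or_gt ‖x‖ (2 * R + 1) with hx | hx
  · refine le_add_of_le_of_nonneg ?_ (by positivity)
    have h1 : ‖g y - g x‖ ≤ (L + 2 * M) * min 1 ‖y - x‖ := by
      rcases le_total 1 ‖y - x‖ with h | h
      · rw [min_eq_left h]
        have := norm_sub_le (g y) (g x)
        linarith [hg.bound x, hg.bound y]
      · rw [min_eq_right h]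
        exact (hg.lip x y).trans (by gcongr; linarith)
    have h2 : 1 ≤ (2 * R + 2) ^ d * decay n α x := by
      unfold decay
      rw [Real.rpow_neg (by positivity), ← div_eq_mul_inv, one_le_div (by positivity)]
      exact Real.rpow_le_rpow (by positivity) (by linarith) hd.le
    have h3 : truncKernel n α (y - x) ≤ pairWeight n α R x y :=
      le_add_of_nonneg_right (Set.indicator_nonneg (fun _ _ => zero_le_one) _)
    calc ‖g y - g x‖ * ‖y - x‖ ^ (-d)
        ≤ (L + 2 * M) * min 1 ‖y - x‖ * ‖y - x‖ ^ (-d) := by gcongr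
      _ = (L + 2 * M) * (1 * truncKernel n α (y - x)) := by rw [truncKernel]; ring
      _ ≤ (L + 2 * M) * (((2 * R + 2) ^ d * decay n α x) * pairWeight n α R x y) := by
          have := truncKernel_nonneg α (y - x)
          gcongr
      _ = _ := by ring
  · refine le_add_of_nonneg_of_le (by positivity) ?_
    have hgx : g x = 0 := hg.eq_zero x (by linarith)
    rcases lt_or_ge R ‖y‖ with hy | hy
    · rw [hgx, hg.eq_zero y hy]
      simp only [sub_self, norm_zero, zero_mul]
      positivity
    have h1 : (1 + ‖x‖) / 2 ≤ ‖y - x‖ := by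
      have := norm_sub_norm_le x y
      rw [norm_sub_rev] at this
      linarith
    have h2 : ‖y - x‖ ^ (-d) ≤ 2 ^ d * decay n α x := by
      calc ‖y - x‖ ^ (-d) ≤ ((1 + ‖x‖) / 2) ^ (-d) :=
            Real.rpow_le_rpow_of_nonpos (by positivity) h1 (by linarith)
        _ = 2 ^ d * decay n α x := by
            rw [Real.div_rpow (by positivity) (by positivity), decay, Real.rpow_neg zero_le_two,
              div_inv_eq_mul, mul_comm]
    have h3 : 1 ≤ pairWeight n α R x y := by
      have : y ∈ Metric.closedBall (0 : Rn n) R := by simpa using hy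
      rw [pairWeight, Set.indicator_of_mem this, Pi.one_apply]
      linarith [truncKernel_nonneg α (y - x)]
    rw [hgx, sub_zero]
    calc ‖g y‖ * ‖y - x‖ ^ (-d) ≤ M * (2 ^ d * decay n α x) := by
          have := hg.bound y
          gcongr
      _ ≤ M * (2 ^ d * decay n α x) * pairWeight n α R x y := le_mul_of_one_le_right (by positivity) h3
      _ = _ := by ring

/-- For finite `p`, the product is at most the weight where `|f| ≤ 1` and at most `|f|^p` elsewhere,
which replaces Hölder's inequality. -/
theorem integrable_mul_decay {α : ℝ} (hα : 0 < α) {p : ENNReal} (hp : 1 ≤ p) {f : Rn n → ℝ}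
    (hf : MemLp f p) : Integrable fun x => f x * decay n α x := by
  have hW : AEStronglyMeasurable (decay n α) volume := (continuous_decay α).aestronglyMeasurable
  rcases eq_or_ne p ⊤ with rfl | hpt
  · exact (integrable_decay hα).bdd_mul (c := (eLpNormEssSup f volume).toReal) hf.1 (by
      have h := hf.2
      rw [eLpNorm_exponent_top] at h
      filter_upwards [ae_le_eLpNormEssSup (f := f) (μ := volume)] with x hx
      simpa using ENNReal.toReal_mono h.ne hx)
  · have h1 := hf.integrable_norm_rpow (by positivity) hpt
    refine ((integrable_decay hα).add h1).mono' (hf.1.mul hW) (.of_forall fun x => ?_)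
    have hp1 : 1 ≤ p.toReal := by
      simpa using ENNReal.toReal_mono hpt hp
    rw [norm_mul, Real.norm_of_nonneg (decay_pos α x).le, Pi.add_apply]
    have hW0 := decay_pos α x
    rcases le_total ‖f x‖ 1 with h | h
    · exact le_add_of_le_of_nonneg (mul_le_of_le_one_left hW0.le h) (by positivity)
    · refine le_add_of_nonneg_of_le hW0.le ?_
      exact (mul_le_of_le_one_right (by positivity) (decay_le_one hα.le x)).trans
        (Real.self_le_rpow_of_one_le h hp1)

/-- The first part of the weight gives the integrand of a convolution of two integrable functions,
the second a tensor product. -/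
theorem integrable_mul_pairWeight (hn : 1 ≤ n) {α : ℝ} (hα : α ∈ Set.Ioo (0 : ℝ) 1) (R : ℝ)
    {F : Rn n → ℝ} (hF : Integrable F) :
    Integrable (fun q : Rn n × Rn n => F q.1 * pairWeight n α R q.1 q.2) (volume.prod volume) := by
  have h1 : Integrable (fun q : Rn n × Rn n => F q.1 * truncKernel n α (q.2 - q.1))
      (volume.prod volume) := by
    have := (hF.convolution_integrand (ContinuousLinearMap.mul ℝ ℝ)
      (integrable_truncKernel hn hα)).swap
    exact this
  have h2 : Integrable (fun q : Rn n × Rn n =>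
      F q.1 * (Metric.closedBall (0 : Rn n) R).indicator (1 : Rn n → ℝ) q.2)
      (volume.prod volume) :=
    hF.mul_prod ((integrable_indicator_iff Metric.isClosed_closedBall.measurableSet).2
      (integrableOn_const (by exact measure_closedBall_lt_top.ne)))
  refine (h1.add h2).congr (.of_forall fun q => ?_)
  simp only [Pi.add_apply, pairWeight]
  ring

theorem integrable_pairWeight (hn : 1 ≤ n) {α : ℝ} (hα : α ∈ Set.Ioo (0 : ℝ) 1) (R : ℝ)
    (x : Rn n) : Integrable (pairWeight n α R x) :=
  ((integrable_truncKernel hn hα).comp_sub_right x).add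
    ((integrable_indicator_iff Metric.isClosed_closedBall.measurableSet).2
      (integrableOn_const (by exact measure_closedBall_lt_top.ne)))

/-- A function on pairs dominated by `|f|` times the quotient of a Lipschitz bump is integrable. -/
theorem integrable_prod_of_le (hn : 1 ≤ n) {α : ℝ} (hα : α ∈ Set.Ioo (0 : ℝ) 1) {p : ENNReal}
    (hp : 1 ≤ p) {f : Rn n → ℝ} (hf : MemLp f p) {C R : ℝ} {J : Rn n × Rn n → E}
    (hJm : AEStronglyMeasurable J (volume.prod volume))
    (hJ : ∀ x y, ‖J (x, y)‖ ≤ C * (|f x| * (decay n α x * pairWeight n α R x y))) :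
    Integrable J (volume.prod volume) := by
  have h := (integrable_mul_pairWeight hn hα R (integrable_mul_decay hα.1 hp hf).norm).const_mul C
  refine h.mono' hJm (.of_forall fun q => (hJ q.1 q.2).trans_eq ?_)
  rw [norm_mul, Real.norm_of_nonneg (decay_pos α q.1).le, Real.norm_eq_abs]
  ring

theorem exists_isLipBump {g : Rn n → E} (hg : ∃ K : NNReal, LipschitzWith K g)
    (hc : HasCompactSupport g) : ∃ L M R : ℝ, 0 ≤ L ∧ 0 ≤ R ∧ IsLipBump L M R g := by
  obtain ⟨K, hK⟩ := hg
  obtain ⟨R, hR⟩ := hc.isCompact.isBounded.subset_closedBall (0 : Rn n)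
  obtain ⟨M, hM⟩ := hK.continuous.bounded_above_of_compact_support hc
  refine ⟨K, M, max R 0, K.2, le_max_right _ _, fun x y => by
    simpa [dist_eq_norm] using hK.dist_le_mul y x, hM, fun x hx => ?_⟩
  by_contra h
  have := hR (subset_tsupport _ h)
  simp only [Metric.mem_closedBall, dist_zero_right] at this
  exact absurd (this.trans (le_max_left R 0)) (not_le.2 hx)

theorem IsLipBump.lipschitzWith {L M R : ℝ} (hL : 0 ≤ L) {g : Rn n → E} (hg : IsLipBump L M R g) :
    LipschitzWith L.toNNReal g :=
  LipschitzWith.of_dist_le_mul fun x y => by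
    simpa [dist_eq_norm, Real.coe_toNNReal _ hL] using hg.lip y x

theorem IsLipBump.hasCompactSupport {L M R : ℝ} {g : Rn n → E} (hg : IsLipBump L M R g) :
    HasCompactSupport g :=
  HasCompactSupport.intro (isCompact_closedBall (0 : Rn n) R) fun x hx =>
    hg.eq_zero x (by simpa using hx)

/-- At `r = 0` both sides vanish, because `0` to a nonzero real power is `0`; hence the diagonal
needs no separate treatment. -/
theorem div_rpow_mul_self {d r : ℝ} (hd : 0 < d) (hr : 0 ≤ r) (a : ℝ) :
    a / r ^ (d + 1) * r = a * r ^ (-d) := by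
  rcases hr.eq_or_lt with rfl | hr
  · rw [Real.zero_rpow (by linarith), Real.zero_rpow (by linarith)]; simp
  · rw [Real.rpow_add hr, Real.rpow_neg hr.le, Real.rpow_one]
    field_simp

end FracBV

end

/-! ### Integration against vector measures with density -/

noncomputable section

section VectorMeasureDensity

open Filter Topology

variable {X E F G : Type*} [MeasurableSpace X]
  [NormedAddCommGroup E] [NormedSpace ℝ E]
  [NormedAddCommGroup F] [NormedSpace ℝ F]
  [NormedAddCommGroup G] [NormedSpace ℝ G]

theorem isFiniteMeasure_variation_withDensityᵥ [CompleteSpace F] {m : Measure X} {h : X → F} (hh : Integrable h m) :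
    IsFiniteMeasure (m.withDensityᵥ h).variation := by
  rw [Measure.variation_withDensityᵥ hh]
  exact ⟨by simpa using! hh.2⟩

theorem withDensityᵥ_restrict {m : Measure X} {h : X → F} (hh : Integrable h m) {s : Set X}
    (hs : MeasurableSet s) : (m.withDensityᵥ h).restrict s = (m.restrict s).withDensityᵥ h := by
  ext t ht
  rw [VectorMeasure.restrict_apply _ hs ht, withDensityᵥ_apply hh (ht.inter hs),
    withDensityᵥ_apply hh.restrict ht, Measure.restrict_restrict ht]

theorem integrable_bilin {m : Measure X} {h : X → F} (hh : Integrable h m)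
    (B : E →L[ℝ] F →L[ℝ] G) {f : X → E} (hf : StronglyMeasurable f) {C : ℝ}
    (hC : ∀ x, ‖f x‖ ≤ C) : Integrable (fun x => B (f x) (h x)) m := by
  refine (hh.norm.const_mul (‖B‖ * C)).mono'
    (B.aestronglyMeasurable_comp₂ hf.aestronglyMeasurable hh.1) (.of_forall fun x => ?_)
  calc ‖B (f x) (h x)‖ ≤ ‖B‖ * ‖f x‖ * ‖h x‖ := B.le_opNorm₂ _ _
    _ ≤ ‖B‖ * C * ‖h x‖ := by gcongr; exact hC x

/-- The integral of a bounded function against a vector measure with density. -/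
theorem integral_withDensityᵥ_eq [CompleteSpace F] [CompleteSpace G] {m : Measure X} {h : X → F} (hh : Integrable h m)
    (B : E →L[ℝ] F →L[ℝ] G) {f : X → E} (hf : StronglyMeasurable f) {C : ℝ}
    (hC : ∀ x, ‖f x‖ ≤ C) :
    (m.withDensityᵥ h).integral f B = ∫ x, B (f x) (h x) ∂m := by
  have hfin := isFiniteMeasure_variation_withDensityᵥ hh
  have simple : ∀ g : SimpleFunc X E,
      (m.withDensityᵥ h).integral g B = ∫ x, B (g x) (h x) ∂m := by
    intro g
    induction g using SimpleFunc.induction with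
    | const c hs =>
      rename_i s
      have e : ∀ x, (SimpleFunc.piecewise s hs (SimpleFunc.const X c) (SimpleFunc.const X 0)) x =
        s.indicator (fun _ => c) x := fun x => by simp [Set.indicator, Set.piecewise]
      have e2 : ∀ x, B (s.indicator (fun _ => c) x) (h x) =
          s.indicator (fun x => B c (h x)) x := fun x => by
        by_cases hx : x ∈ s <;> simp [hx]
      rw [show (⇑(SimpleFunc.piecewise s hs (SimpleFunc.const X c) (SimpleFunc.const X 0))) =
        s.indicator (fun _ => c) from funext e]
      simp_rw [e2]
      rw [integral_indicator hs, VectorMeasure.integral_indicator_const c hs,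
        withDensityᵥ_apply hh hs, (B c).integral_comp_comm hh.integrableOn]
    | @add f g _ hf hg =>
      obtain ⟨C₁, hC₁⟩ := f.exists_forall_norm_le
      obtain ⟨C₂, hC₂⟩ := g.exists_forall_norm_le
      have i₁ := integrable_bilin hh B f.stronglyMeasurable hC₁
      have i₂ := integrable_bilin hh B g.stronglyMeasurable hC₂
      have := VectorMeasure.integral_add (B := B) (μ := m.withDensityᵥ h)
        (f.integrable_of_isFiniteMeasure) (g.integrable_of_isFiniteMeasure)
      rw [SimpleFunc.coe_add]
      refine this.trans ?_
      rw [hf, hg, ← integral_add i₁ i₂]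
      simp
  -- These approximations keep the bound `C`, so dominated convergence applies to both integrals.
  set g : ℕ → SimpleFunc X E := fun k => hf.approxBounded C k
  have hgC : ∀ k x, ‖g k x‖ ≤ C := fun k x =>
    hf.norm_approxBounded_le ((norm_nonneg _).trans (hC x)) k x
  have hlim : ∀ x, Tendsto (fun k => g k x) atTop (𝓝 (f x)) := fun x =>
    hf.tendsto_approxBounded_of_norm_le (hC x)
  have t1 := VectorMeasure.tendsto_integral_of_dominated_convergence (B := B)
    (μ := m.withDensityᵥ h) (f := f) (fun _ => C)
    (fun k => (g k).aestronglyMeasurable) (integrable_const C)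
    (fun k => .of_forall (hgC k)) (.of_forall hlim)
  have t2 : Tendsto (fun k => ∫ x, B (g k x) (h x) ∂m) atTop (𝓝 (∫ x, B (f x) (h x) ∂m)) := by
    refine tendsto_integral_of_dominated_convergence (fun x => ‖B‖ * C * ‖h x‖)
      (fun k => (integrable_bilin hh B (g k).stronglyMeasurable (hgC k)).1)
      (hh.norm.const_mul _) (fun k => .of_forall fun x => ?_) (.of_forall fun x => ?_)
    · calc ‖B (g k x) (h x)‖ ≤ ‖B‖ * ‖g k x‖ * ‖h x‖ := B.le_opNorm₂ _ _
        _ ≤ ‖B‖ * C * ‖h x‖ := by gcongr; exact hgC k x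
    · exact ((B.flip (h x)).continuous.tendsto (f x)).comp (hlim x)
  refine tendsto_nhds_unique t1 (t2.congr fun k => (simple (g k)).symm)

/-- A bounded density on top of an integrable density. -/
theorem withDensity_withDensityᵥ [CompleteSpace F] {m : Measure X} {h : X → F} (hh : Integrable h m)
    {f : X → ℝ} (hf : StronglyMeasurable f) {C : ℝ} (hC : ∀ x, ‖f x‖ ≤ C) :
    (m.withDensityᵥ h).withDensity f (ContinuousLinearMap.lsmul ℝ ℝ) =
      m.withDensityᵥ fun x => f x • h x := by
  have hfin := isFiniteMeasure_variation_withDensityᵥ hh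
  have hfi : (m.withDensityᵥ h).Integrable f :=
    Integrable.of_bound hf.aestronglyMeasurable C (.of_forall hC)
  have hfh : Integrable (fun x => f x • h x) m :=
    integrable_bilin hh (ContinuousLinearMap.lsmul ℝ ℝ) hf hC
  ext s hs
  rw [VectorMeasure.withDensity_apply hfi, withDensityᵥ_restrict hh hs,
    integral_withDensityᵥ_eq hh.restrict _ hf hC, withDensityᵥ_apply hfh hs]
  simp

end VectorMeasureDensity

/-! ### Densities of vector measures and uniqueness of the fractional variation -/

namespace FracBV

variable {n : ℕ}

/-- The vector measure on `ℝⁿ` whose `i`-th coordinate is `P i - N i` has a density with respect to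
the finite measure `∑ i, (P i + N i)`. -/
theorem exists_density_of_measures (P N : Fin n → Measure (Rn n)) [∀ i, IsFiniteMeasure (P i)]
    [∀ i, IsFiniteMeasure (N i)] :
    ∃ (m : Measure (Rn n)) (h : Rn n → Rn n), IsFiniteMeasure m ∧ Integrable h m ∧
      ∀ i (f : Rn n → ℝ), Integrable f (P i) → Integrable f (N i) →
        Integrable (fun x => f x * h x i) m ∧
        ∫ x, f x * h x i ∂m = ∫ x, f x ∂P i - ∫ x, f x ∂N i := by
  -- Every `P i` and `N i` is absolutely continuous with respect to the total sum, so one reference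
  -- measure serves all coordinates.
  set m : Measure (Rn n) := ∑ i, (P i + N i)
  have hle : ∀ i, P i + N i ≤ m := fun i =>
    Finset.single_le_sum (f := fun i => P i + N i) (fun _ _ => Measure.zero_le _) (Finset.mem_univ i)
  have hP : ∀ i, P i ≪ m := fun i =>
    Measure.absolutelyContinuous_of_le ((Measure.le_add_right le_rfl).trans (hle i))
  have hN : ∀ i, N i ≪ m := fun i =>
    Measure.absolutelyContinuous_of_le ((Measure.le_add_left le_rfl).trans (hle i))
  have hm : IsFiniteMeasure m := by infer_instance
  have key : ∀ i (f : Rn n → ℝ), Integrable f (P i) → Integrable f (N i) →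
      Integrable (fun x => f x * (((P i).rnDeriv m x).toReal - ((N i).rnDeriv m x).toReal)) m ∧
      ∫ x, f x * (((P i).rnDeriv m x).toReal - ((N i).rnDeriv m x).toReal) ∂m =
        ∫ x, f x ∂P i - ∫ x, f x ∂N i := by
    intro i f hfP hfN
    have e : (fun x => f x * (((P i).rnDeriv m x).toReal - ((N i).rnDeriv m x).toReal)) =
        (fun x => ((P i).rnDeriv m x).toReal • f x) - fun x => ((N i).rnDeriv m x).toReal • f x := by
      ext x; simp; ring
    have : SigmaFinite m := inferInstance
    have : (P i).HaveLebesgueDecomposition m := inferInstance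
    have iP := (integrable_rnDeriv_smul_iff (hP i)).2 hfP
    have iN := (integrable_rnDeriv_smul_iff (hN i)).2 hfN
    rw [e]
    refine ⟨iP.sub iN, ?_⟩
    rw [← integral_rnDeriv_smul (hP i), ← integral_rnDeriv_smul (hN i)]
    exact integral_sub iP iN
  refine ⟨m, fun x => WithLp.toLp 2 fun i =>
    ((P i).rnDeriv m x).toReal - ((N i).rnDeriv m x).toReal, inferInstance, ?_, key⟩
  rw [← (PiLp.continuousLinearEquiv 2 ℝ fun _ : Fin n => ℝ).integrable_comp_iff]
  refine Integrable.of_eval fun i => ?_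
  simpa using (key i 1 (integrable_const _) (integrable_const _)).1

/-- Jordan decomposition of each coordinate supplies the measures `P i` and `N i`. This reduces
questions on vector measures to integrable functions. -/
theorem exists_eq_withDensityᵥ (μ : VectorMeasure (Rn n) (Rn n)) :
    ∃ (m : Measure (Rn n)) (h : Rn n → Rn n), IsFiniteMeasure m ∧ Integrable h m ∧
      μ = m.withDensityᵥ h := by
  set σ : Fin n → SignedMeasure (Rn n) := fun i =>
    μ.mapRange (EuclideanSpace.proj i : Rn n →L[ℝ] ℝ).toLinearMap.toAddMonoidHom
      (EuclideanSpace.proj i : Rn n →L[ℝ] ℝ).continuous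
  obtain ⟨m, h, hm, hh, H⟩ := exists_density_of_measures
    (fun i => (σ i).toJordanDecomposition.posPart) (fun i => (σ i).toJordanDecomposition.negPart)
  refine ⟨m, h, hm, hh, ?_⟩
  ext s hs i
  have h1 : (σ i) s = μ s i := rfl
  rw [← h1, withDensityᵥ_apply hh hs]
  have h2 : (∫ x in s, h x ∂m) i = ∫ x in s, h x i ∂m :=
    ((EuclideanSpace.proj i : Rn n →L[ℝ] ℝ).integral_comp_comm hh.integrableOn).symm
  have h3 := (H i (s.indicator 1) ((integrable_const 1).indicator hs)
    ((integrable_const 1).indicator hs)).2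
  have h4 : (fun x => s.indicator (1 : Rn n → ℝ) x * h x i) = s.indicator fun x => h x i := by
    ext x; by_cases hx : x ∈ s <;> simp [hx]
  rw [h4, integral_indicator hs, integral_indicator_one hs, integral_indicator_one hs] at h3
  rw [h2, h3]
  exact (σ i).apply_eq_posPart_real_sub_negPart_real hs

/-- A vector measure integrating all test fields to zero vanishes. -/
theorem eq_zero_of_integral_testField {μ : VectorMeasure (Rn n) (Rn n)}
    (hμ : ∀ φ, IsTestField φ → μ.integral φ (innerSL ℝ) = 0) : μ = 0 := by
  obtain ⟨m, h, hm, hh, rfl⟩ := exists_eq_withDensityᵥ μ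
  -- Testing with `g v`, `v` a fixed vector, recovers every component of `∫ g h`; the fundamental
  -- lemma then applies to `h`.
  have h0 : ∀ᵐ x ∂m, h x = 0 := by
    refine ae_eq_zero_of_integral_contDiff_smul_eq_zero hh.locallyIntegrable fun g hg hgc => ?_
    obtain ⟨C, hC⟩ := hg.continuous.bounded_above_of_compact_support hgc
    have hgh : Integrable (fun x => g x • h x) m :=
      integrable_bilin hh (ContinuousLinearMap.lsmul ℝ ℝ) hg.continuous.stronglyMeasurable hC
    refine ext_inner_left ℝ fun v => ?_
    rw [inner_zero_right, ← integral_inner hgh]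
    have hφ : IsTestField fun x => g x • v := ⟨hg.smul contDiff_const, hgc.smul_right⟩
    have := hμ _ hφ
    rw [integral_withDensityᵥ_eq hh (innerSL ℝ) hφ.1.continuous.stronglyMeasurable
      (C := C * ‖v‖) (fun x => by rw [norm_smul]; gcongr; exact hC x)] at this
    rw [← this]
    congr with x
    rw [innerSL_apply_apply, real_inner_smul_left, real_inner_smul_right]
  rw [WithDensityᵥEq.congr_ae (g := 0) h0, withDensityᵥ_zero]

theorem IsTestField.bounded {φ : Rn n → Rn n} (hφ : IsTestField φ) : ∃ C, ∀ x, ‖φ x‖ ≤ C :=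
  hφ.1.continuous.bounded_above_of_compact_support hφ.2

theorem IsFracVariationMeasure.unique {α : ℝ} {f : Rn n → ℝ} {μ ν : VectorMeasure (Rn n) (Rn n)}
    (hμ : IsFracVariationMeasure α f μ) (hν : IsFracVariationMeasure α f ν) : μ = ν := by
  have : IsFiniteMeasure μ.variation := ⟨hμ.1⟩
  have : IsFiniteMeasure ν.variation := ⟨hν.1⟩
  rw [← sub_eq_zero]
  refine eq_zero_of_integral_testField fun φ hφ => ?_
  rw [VectorMeasure.integral_sub_vectorMeasure
    (hφ.1.continuous.integrable_of_hasCompactSupport hφ.2)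
    (hφ.1.continuous.integrable_of_hasCompactSupport hφ.2), sub_eq_zero, ← neg_inj,
    ← hμ.2 φ hφ, ← hν.2 φ hφ]

theorem fracVariation_eq {α : ℝ} {f : Rn n → ℝ} {μ : VectorMeasure (Rn n) (Rn n)}
    (hμ : IsFracVariationMeasure α f μ) : fracVariation α f = μ := by
  have h : ∃ μ, IsFracVariationMeasure α f μ := ⟨μ, hμ⟩
  rw [fracVariation, dif_pos h]
  exact h.choose_spec.unique hμ

end FracBV

end

/-! ### A Riesz representation for bounded functionals on subspaces of `C_c` -/

noncomputable section

section SignedRiesz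

open CompactlySupported

variable {X : Type*} [TopologicalSpace X]

/-- The sublinear functional `(u, v) ↦ sup (u⁺ + v⁺)` on pairs of functions. -/
def supPosPart (w : C_c(X, ℝ) × C_c(X, ℝ)) : ℝ := ⨆ x, (max (w.1 x) 0 + max (w.2 x) 0)

theorem bddAbove_supPosPart (w : C_c(X, ℝ) × C_c(X, ℝ)) :
    BddAbove (Set.range fun x => max (w.1 x) 0 + max (w.2 x) 0) := by
  obtain ⟨C₁, h₁⟩ := w.1.hasCompactSupport.exists_bound_of_continuous w.1.continuous
  obtain ⟨C₂, h₂⟩ := w.2.hasCompactSupport.exists_bound_of_continuous w.2.continuous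
  refine ⟨C₁ + C₂, ?_⟩
  rintro _ ⟨x, rfl⟩
  have a₁ := abs_le.1 (h₁ x)
  have a₂ := abs_le.1 (h₂ x)
  have b₁ := (abs_nonneg _).trans (h₁ x)
  have b₂ := (abs_nonneg _).trans (h₂ x)
  exact add_le_add (max_le a₁.2 b₁) (max_le a₂.2 b₂)

theorem le_supPosPart (w : C_c(X, ℝ) × C_c(X, ℝ)) (x : X) :
    max (w.1 x) 0 + max (w.2 x) 0 ≤ supPosPart w :=
  le_ciSup (bddAbove_supPosPart w) x

theorem supPosPart_nonneg (w : C_c(X, ℝ) × C_c(X, ℝ)) : 0 ≤ supPosPart w :=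
  Real.iSup_nonneg fun _ => by positivity

theorem supPosPart_smul {c : ℝ} (hc : 0 < c) (w : C_c(X, ℝ) × C_c(X, ℝ)) :
    supPosPart (c • w) = c * supPosPart w := by
  unfold supPosPart
  rw [Real.mul_iSup_of_nonneg hc.le]
  congr with x
  simp only [Prod.smul_fst, Prod.smul_snd, CompactlySupportedContinuousMap.smul_apply, smul_eq_mul]
  rw [mul_add, mul_max_of_nonneg _ _ hc.le, mul_max_of_nonneg _ _ hc.le, mul_zero]

theorem supPosPart_add (w z : C_c(X, ℝ) × C_c(X, ℝ)) :
    supPosPart (w + z) ≤ supPosPart w + supPosPart z := by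
  refine Real.iSup_le (fun x => ?_) (add_nonneg (supPosPart_nonneg w) (supPosPart_nonneg z))
  have h₁ := le_supPosPart w x
  have h₂ := le_supPosPart z x
  have aux : ∀ a b : ℝ, max (a + b) 0 ≤ max a 0 + max b 0 := fun a b =>
    max_le (add_le_add (le_max_left _ _) (le_max_left _ _)) (by positivity)
  have h₃ := aux (w.1 x) (z.1 x)
  have h₄ := aux (w.2 x) (z.2 x)
  simp only [Prod.fst_add, Prod.snd_add, CompactlySupportedContinuousMap.add_apply]
  linarith

variable [T2Space X] [LocallyCompactSpace X] [MeasurableSpace X] [BorelSpace X]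

/-- Inner regularity reduces to compact sets, whose measure is controlled by a cutoff with values in
`[0, 1]`. -/
theorem isFiniteMeasure_rieszMeasure (Λ : C_c(X, ℝ) →ₚ[ℝ] ℝ) {C : ℝ}
    (hC : ∀ g : C_c(X, ℝ), (∀ x, g x ≤ 1) → Λ g ≤ C) : IsFiniteMeasure (RealRMK.rieszMeasure Λ) := by
  refine ⟨lt_of_le_of_lt ?_ (ENNReal.ofReal_lt_top (r := C))⟩
  rw [isOpen_univ.measure_eq_iSup_isCompact]
  refine iSup₂_le fun K _ => iSup_le fun hK => ?_
  obtain ⟨f, hf1, -, hfc, hf01⟩ := exists_continuous_one_zero_of_isCompact hK isClosed_empty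
    (Set.disjoint_empty K)
  let g : C_c(X, ℝ) := ⟨f, hfc⟩
  exact (RealRMK.rieszMeasure_le_of_eq_one Λ (f := g) (fun x => (hf01 x).1) hK hf1).trans
    (ENNReal.ofReal_le_ofReal (hC g fun x => (hf01 x).2))

/-- A linear functional on a space of compactly supported continuous functions which is bounded for
the supremum norm is the difference of the integrals against two finite measures. -/
theorem exists_measures_of_bounded_functional (S : Submodule ℝ C_c(X, ℝ)) (ℓ : S →ₗ[ℝ] ℝ) {C : ℝ}
    (hC0 : 0 ≤ C) (hC : ∀ (g : S) (c : ℝ), 0 ≤ c → (∀ x, |(g : C_c(X, ℝ)) x| ≤ c) → ℓ g ≤ C * c) :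
    ∃ P N : Measure X, IsFiniteMeasure P ∧ IsFiniteMeasure N ∧
      ∀ g : S, ℓ g = ∫ x, (g : C_c(X, ℝ)) x ∂P - ∫ x, (g : C_c(X, ℝ)) x ∂N := by
  -- `S` is embedded as the antidiagonal `(g, -g)`, where `supPosPart` is the supremum norm of `g`.
  -- A Hahn–Banach extension below `C * supPosPart` then encodes the difference of two positive
  -- functionals, with no density of `S` required.
  let D : Submodule ℝ (C_c(X, ℝ) × C_c(X, ℝ)) :=
    { carrier := {w | w.1 ∈ S ∧ w.2 = -w.1}
      add_mem' := fun {a b} ha hb => ⟨S.add_mem ha.1 hb.1, by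
        rw [Prod.snd_add, ha.2, hb.2, Prod.fst_add, neg_add]⟩
      zero_mem' := ⟨S.zero_mem, by simp⟩
      smul_mem' := fun c a ha => ⟨S.smul_mem c ha.1, by
        rw [Prod.smul_snd, ha.2, Prod.smul_fst]
        ext x
        simp⟩ }
  let F : (C_c(X, ℝ) × C_c(X, ℝ)) →ₗ.[ℝ] ℝ :=
    ⟨D, { toFun := fun w => ℓ ⟨w.1.1, w.2.1⟩
          map_add' := fun a b => ℓ.map_add ⟨a.1.1, a.2.1⟩ ⟨b.1.1, b.2.1⟩
          map_smul' := fun c a => ℓ.map_smul c ⟨a.1.1, a.2.1⟩ }⟩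
  obtain ⟨G, hGF, hGN⟩ := exists_extension_of_le_sublinear F (fun w => C * supPosPart w)
    (fun c hc w => by rw [supPosPart_smul hc]; ring)
    (fun w z => by
      rw [← mul_add]
      exact mul_le_mul_of_nonneg_left (supPosPart_add w z) hC0)
    (fun w => hC ⟨w.1.1, w.2.1⟩ _ (supPosPart_nonneg _) fun x => by
      have h := le_supPosPart w.1 x
      have h2 : w.1.2 x = -(w.1.1 x) := by rw [w.2.2]; rfl
      rw [h2] at h
      refine le_trans ?_ h
      rcases abs_cases (w.1.1 x) with ⟨e, _⟩ | ⟨e, _⟩ <;> rw [e]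
      · exact le_add_of_le_of_nonneg (le_max_left _ _) (le_max_right _ _)
      · exact le_add_of_nonneg_of_le (le_max_right _ _) (le_max_left _ _))
  -- The majorant vanishes on nonpositive pairs, which makes `G (·, 0)` and `G (0, ·)` positive.
  have hneg : ∀ u v : C_c(X, ℝ), (∀ x, u x ≤ 0) → (∀ x, v x ≤ 0) → G (u, v) ≤ 0 := by
    intro u v hu hv
    refine (hGN (u, v)).trans ?_
    have : supPosPart (u, v) ≤ 0 := Real.iSup_le (fun x => by
      simp only [max_eq_right (hu x), max_eq_right (hv x), add_zero, le_refl]) le_rfl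
    exact mul_nonpos_of_nonneg_of_nonpos hC0 this
  have hone : ∀ u v : C_c(X, ℝ), (∀ x, max (u x) 0 + max (v x) 0 ≤ 1) → G (u, v) ≤ C := fun u v h =>
    (hGN (u, v)).trans (mul_le_of_le_one_right hC0 (Real.iSup_le h zero_le_one))
  let P : C_c(X, ℝ) →ₚ[ℝ] ℝ := PositiveLinearMap.mk₀ (G ∘ₗ LinearMap.inl ℝ _ _) fun u hu => by
    have h := hneg (-u) 0 (fun x => by simpa using hu x) (fun x => le_rfl)
    have e : ((-u, 0) : C_c(X, ℝ) × C_c(X, ℝ)) = -(u, 0) := by simp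
    rw [e, map_neg] at h
    simpa using h
  let Q : C_c(X, ℝ) →ₚ[ℝ] ℝ := PositiveLinearMap.mk₀ (G ∘ₗ LinearMap.inr ℝ _ _) fun u hu => by
    have h := hneg 0 (-u) (fun x => le_rfl) (fun x => by simpa using hu x)
    have e : ((0, -u) : C_c(X, ℝ) × C_c(X, ℝ)) = -(0, u) := by simp
    rw [e, map_neg] at h
    simpa using h
  have hP : ∀ u, P u = G (u, 0) := fun u => rfl
  have hQ : ∀ u, Q u = G (0, u) := fun u => rfl
  refine ⟨RealRMK.rieszMeasure P, RealRMK.rieszMeasure Q,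
    isFiniteMeasure_rieszMeasure P (C := C) fun g hg => hone g 0 fun x => by simpa using hg x,
    isFiniteMeasure_rieszMeasure Q (C := C) fun g hg => hone 0 g fun x => by simpa using hg x,
    fun g => ?_⟩
  rw [RealRMK.integral_rieszMeasure, RealRMK.integral_rieszMeasure, hP, hQ, ← map_sub]
  have h := hGF ⟨((g : C_c(X, ℝ)), -(g : C_c(X, ℝ))), g.2, rfl⟩
  refine h.symm.trans ?_
  simp

end SignedRiesz

end

/-! ### The fractional divergence, mollification and Lipschitz test fields -/

noncomputable section

namespace FracBV

open Filter Topology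

variable {n : ℕ} {E : Type*} [NormedAddCommGroup E]

theorem abs_inner_div_le {α : ℝ} (hα : 0 < α) (v w : Rn n) :
    |inner ℝ v w / ‖v‖ ^ ((n : ℝ) + α + 1)| ≤ ‖w‖ * ‖v‖ ^ (-((n : ℝ) + α)) := by
  rw [← div_rpow_mul_self (by positivity) (norm_nonneg v), abs_div,
    abs_of_nonneg (by positivity : 0 ≤ ‖v‖ ^ ((n : ℝ) + α + 1)), div_mul_eq_mul_div]
  gcongr
  rw [mul_comm]
  exact abs_real_inner_le_norm v w

theorem norm_div_smul {α : ℝ} (hα : 0 < α) (a : ℝ) (v : Rn n) :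
    ‖(a / ‖v‖ ^ ((n : ℝ) + α + 1)) • v‖ = |a| * ‖v‖ ^ (-((n : ℝ) + α)) := by
  rw [← div_rpow_mul_self (by positivity) (norm_nonneg v), norm_smul, Real.norm_eq_abs, abs_div,
    abs_of_nonneg (by positivity : 0 ≤ ‖v‖ ^ ((n : ℝ) + α + 1))]

/-- The integrand of the fractional divergence. -/
def fracDivKernel (α : ℝ) (φ : Rn n → Rn n) (x y : Rn n) : ℝ :=
  inner ℝ (y - x) (φ y - φ x) / ‖y - x‖ ^ ((n : ℝ) + α + 1)

theorem fracDiv_eq (α : ℝ) (φ : Rn n → Rn n) (x : Rn n) :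
    fracDiv α φ x = fracConst n α * ∫ y, fracDivKernel α φ x y := rfl

theorem measurable_norm_sub_rpow (d : ℝ) :
    Measurable fun q : Rn n × Rn n => ‖q.2 - q.1‖ ^ d :=
  (measurable_snd.sub measurable_fst).norm.pow_const d

theorem measurable_fracDivKernel (α : ℝ) {φ : Rn n → Rn n} (hφ : Continuous φ) :
    Measurable fun q : Rn n × Rn n => fracDivKernel α φ q.1 q.2 := by
  have h : Continuous fun q : Rn n × Rn n => inner ℝ (q.2 - q.1) (φ q.2 - φ q.1) := by fun_prop
  exact h.measurable.div (measurable_norm_sub_rpow _)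

theorem IsLipBump.continuous {L M R : ℝ} (hL : 0 ≤ L) {g : Rn n → E} (hg : IsLipBump L M R g) :
    Continuous g :=
  (hg.lipschitzWith hL).continuous

theorem IsLipBump.abs_fracDivKernel_le {α L M R : ℝ} (hα : 0 < α) (hL : 0 ≤ L) (hR : 0 ≤ R)
    {φ : Rn n → Rn n} (hφ : IsLipBump L M R φ) (x y : Rn n) :
    |fracDivKernel α φ x y| ≤ bumpConst n α L M R * (decay n α x * pairWeight n α R x y) :=
  (abs_inner_div_le hα _ _).trans (hφ.quotient_le hα hL hR x y)

theorem IsLipBump.integrable_fracDivKernel (hn : 1 ≤ n) {α : ℝ} (hα : α ∈ Set.Ioo (0 : ℝ) 1)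
    {L M R : ℝ} (hL : 0 ≤ L) (hR : 0 ≤ R) {φ : Rn n → Rn n} (hφ : IsLipBump L M R φ) (x : Rn n) :
    Integrable (fracDivKernel α φ x) :=
  (((integrable_pairWeight hn hα R x).const_mul (decay n α x)).const_mul _).mono'
    ((measurable_fracDivKernel α (hφ.continuous hL)).comp measurable_prodMk_left).aestronglyMeasurable
    (.of_forall fun y => hφ.abs_fracDivKernel_le hα.1 hL hR x y)

theorem IsLipBump.abs_mul_fracDivKernel_le {α L M R : ℝ} (hα : 0 < α) (hL : 0 ≤ L) (hR : 0 ≤ R)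
    {φ : Rn n → Rn n} (hφ : IsLipBump L M R φ) (f : Rn n → ℝ) (x y : Rn n) :
    ‖f x * fracDivKernel α φ x y‖ ≤
      bumpConst n α L M R * (|f x| * (decay n α x * pairWeight n α R x y)) := by
  rw [norm_mul, Real.norm_eq_abs, Real.norm_eq_abs, mul_left_comm]
  gcongr
  exact hφ.abs_fracDivKernel_le hα hL hR x y

theorem aestronglyMeasurable_fst {f : Rn n → ℝ} {p : ENNReal} (hf : MemLp f p) :
    AEStronglyMeasurable (fun q : Rn n × Rn n => f q.1) (volume.prod volume) :=
  hf.1.comp_fst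

section

variable (hn : 1 ≤ n) {α : ℝ} (hα : α ∈ Set.Ioo (0 : ℝ) 1) {p : ENNReal} (hp : 1 ≤ p)
  {f : Rn n → ℝ} (hf : MemLp f p) {L M R : ℝ} (hL : 0 ≤ L) (hR : 0 ≤ R)
  {φ : Rn n → Rn n} (hφ : IsLipBump L M R φ)

include hn hα hp hf hL hR hφ

theorem IsLipBump.integrable_mul_fracDivKernel :
    Integrable (fun q : Rn n × Rn n => f q.1 * fracDivKernel α φ q.1 q.2)
      (volume.prod volume) :=
  integrable_prod_of_le hn hα hp hf ((aestronglyMeasurable_fst hf).mul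
    (measurable_fracDivKernel α (hφ.continuous hL)).aestronglyMeasurable)
    (hφ.abs_mul_fracDivKernel_le hα.1 hL hR f)

theorem IsLipBump.integrable_mul_fracDiv : Integrable fun x => f x * fracDiv α φ x := by
  refine ((hφ.integrable_mul_fracDivKernel hn hα hp hf hL hR).integral_prod_left.const_mul
    (fracConst n α)).congr (.of_forall fun x => ?_)
  simp only [integral_const_mul, fracDiv_eq]
  ring

/-- A single integral over pairs is the form suited to dominated convergence and to exchanging the
variables. -/
theorem IsLipBump.integral_mul_fracDiv :
    ∫ x, f x * fracDiv α φ x = fracConst n α *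
      ∫ q : Rn n × Rn n, f q.1 * fracDivKernel α φ q.1 q.2 ∂(volume.prod volume) := by
  rw [integral_prod _ (hφ.integrable_mul_fracDivKernel hn hα hp hf hL hR), ← integral_const_mul]
  congr with x
  simp only [integral_const_mul, fracDiv_eq]
  ring

end

theorem IsTestField.exists_isLipBump {φ : Rn n → Rn n} (hφ : IsTestField φ) :
    ∃ L M R : ℝ, 0 ≤ L ∧ 0 ≤ R ∧ IsLipBump L M R φ :=
  FracBV.exists_isLipBump (hφ.1.lipschitzWith_of_hasCompactSupport hφ.2 (by simp)) hφ.2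

section Mollify

variable [NormedSpace ℝ E]

theorem norm_integral_normed_smul_le (b : ContDiffBump (0 : Rn n)) {ψ : Rn n → E} {B : ℝ}
    (hB : ∀ t, ‖ψ t‖ ≤ B) : ‖∫ t, b.normed volume t • ψ t‖ ≤ B := by
  calc ‖∫ t, b.normed volume t • ψ t‖ ≤ ∫ t, b.normed volume t * B := by
        refine norm_integral_le_of_norm_le (b.integrable_normed.mul_const B) (.of_forall fun t => ?_)
        rw [norm_smul, Real.norm_of_nonneg (b.nonneg_normed t)]
        exact mul_le_mul_of_nonneg_left (hB t) (b.nonneg_normed t)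
    _ = B := by rw [integral_mul_const, b.integral_normed, one_mul]

theorem integrable_normed_smul (b : ContDiffBump (0 : Rn n)) {ψ : Rn n → E} (hψ : Continuous ψ) :
    Integrable fun t => b.normed volume t • ψ t :=
  (b.continuous_normed.smul hψ).integrable_of_hasCompactSupport b.hasCompactSupport_normed.smul_right

/-- Lipschitz bumps are pointwise limits of smooth bumps with the same constants. -/
theorem IsLipBump.exists_smooth_approx [CompleteSpace E] {L M R : ℝ} (hL : 0 ≤ L) {g : Rn n → E}
    (hg : IsLipBump L M R g) :
    ∃ G : ℕ → Rn n → E, (∀ k, ContDiff ℝ ∞ (G k)) ∧ (∀ k, IsLipBump L M (R + 1) (G k)) ∧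
      ∀ x, Tendsto (fun k => G k x) atTop (𝓝 (g x)) := by
  have hgc := hg.continuous hL
  let b : ℕ → ContDiffBump (0 : Rn n) := fun k =>
    ⟨1 / (2 * ((k : ℝ) + 1)), 1 / ((k : ℝ) + 1), by positivity, by
      apply one_div_lt_one_div_of_lt <;> [positivity; linarith [k.cast_nonneg (α := ℝ)]]⟩
  have hb0 : Tendsto (fun k => (b k).rOut) atTop (𝓝 0) := tendsto_one_div_add_atTop_nhds_zero_nat
  have hb1 : ∀ k, (b k).rOut ≤ 1 := fun k =>
    (div_le_one (by positivity)).2 (by linarith [k.cast_nonneg (α := ℝ)])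
  have hcont : ∀ x, Continuous fun t => g (x - t) := fun x => by fun_prop
  -- Averaging translates against a probability density of radius at most `1` preserves `L` and `M`
  -- and enlarges `R` by at most `1`.
  refine ⟨fun k x => ∫ t, (b k).normed volume t • g (x - t), fun k => ?_, fun k => ⟨?_, ?_, ?_⟩,
    fun x => ?_⟩
  · exact (b k).hasCompactSupport_normed.contDiff_convolution_left
      (ContinuousLinearMap.lsmul ℝ ℝ) (b k).contDiff_normed hgc.locallyIntegrable
  · intro x y
    rw [← integral_sub (integrable_normed_smul _ (hcont y)) (integrable_normed_smul _ (hcont x))]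
    simp_rw [← smul_sub]
    refine norm_integral_normed_smul_le _ fun t => ?_
    simpa using hg.lip (x - t) (y - t)
  · exact fun x => norm_integral_normed_smul_le _ fun t => hg.bound _
  · intro x hx
    refine integral_eq_zero_of_ae (.of_forall fun t => ?_)
    by_cases ht : t ∈ Function.support ((b k).normed volume)
    · rw [ContDiffBump.support_normed_eq, mem_ball_zero_iff] at ht
      have h1 := norm_sub_norm_le x t
      simp only [Pi.zero_apply]
      rw [hg.eq_zero _ (by linarith [hb1 k]), smul_zero]
    · rw [Function.notMem_support] at ht
      simp [ht]
  · exact ContDiffBump.convolution_tendsto_right_of_continuous (μ := volume) (φ := b) hb0 hgc x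

end Mollify

/-- The defining identity of the fractional variation measure extends to Lipschitz fields. -/
theorem IsFracVariationMeasure.integral_lipBump (hn : 1 ≤ n) {α : ℝ} (hα : α ∈ Set.Ioo (0 : ℝ) 1)
    {p : ENNReal} (hp : 1 ≤ p) {f : Rn n → ℝ} (hf : MemLp f p) {m : Measure (Rn n)}
    {h : Rn n → Rn n} (hh : Integrable h m) (hμ : IsFracVariationMeasure α f (m.withDensityᵥ h))
    {L M R : ℝ} (hL : 0 ≤ L) (hR : 0 ≤ R) {ψ : Rn n → Rn n} (hψ : IsLipBump L M R ψ) :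
    ∫ x, f x * fracDiv α ψ x = - ∫ x, inner ℝ (ψ x) (h x) ∂m := by
  -- The approximants share their constants, so one dominating function serves all `k`. Convergence
  -- at every point is used on the measure side, since `m` may be singular.
  obtain ⟨G, hGs, hG, hlim⟩ := hψ.exists_smooth_approx hL
  have hR1 : 0 ≤ R + 1 := by linarith
  have hGt : ∀ k, IsTestField (G k) := fun k => ⟨hGs k, (hG k).hasCompactSupport⟩
  have hid : ∀ k, ∫ x, f x * fracDiv α (G k) x = - ∫ x, inner ℝ (G k x) (h x) ∂m := fun k => by
    rw [hμ.2 _ (hGt k), integral_withDensityᵥ_eq hh (innerSL ℝ) (hGs k).continuous.stronglyMeasurable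
      (hG k).bound]
    rfl
  have hM : 0 ≤ M := (norm_nonneg _).trans (hψ.bound 0)
  have t1 : Tendsto (fun k => ∫ x, f x * fracDiv α (G k) x) atTop
      (𝓝 (∫ x, f x * fracDiv α ψ x)) := by
    rw [hψ.integral_mul_fracDiv hn hα hp hf hL hR]
    simp_rw [fun k => (hG k).integral_mul_fracDiv hn hα hp hf hL hR1]
    refine Tendsto.const_mul _ ?_
    refine tendsto_integral_of_dominated_convergence
      (fun q => bumpConst n α L M (R + 1) *
        (|f q.1| * (decay n α q.1 * pairWeight n α (R + 1) q.1 q.2)))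
      (fun k => ((hG k).integrable_mul_fracDivKernel hn hα hp hf hL hR1).1) ?_
      (fun k => .of_forall fun q => (hG k).abs_mul_fracDivKernel_le hα.1 hL hR1 f q.1 q.2)
      (.of_forall fun q => ?_)
    · have := (integrable_mul_pairWeight hn hα (R + 1) (integrable_mul_decay hα.1 hp hf).norm).const_mul
        (bumpConst n α L M (R + 1))
      refine this.congr (.of_forall fun q => ?_)
      simp only [norm_mul, Real.norm_of_nonneg (decay_pos α q.1).le, Real.norm_eq_abs]
      ring
    · exact ((tendsto_const_nhds.inner ((hlim _).sub (hlim _))).div_const _).const_mul _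
  have t2 : Tendsto (fun k => ∫ x, inner ℝ (G k x) (h x) ∂m) atTop
      (𝓝 (∫ x, inner ℝ (ψ x) (h x) ∂m)) := by
    refine tendsto_integral_of_dominated_convergence (fun x => M * ‖h x‖)
      (fun k => (hGs k).continuous.aestronglyMeasurable.inner hh.1) (hh.norm.const_mul M)
      (fun k => .of_forall fun x => (norm_inner_le_norm _ _).trans ?_)
      (.of_forall fun x => (hlim x).inner tendsto_const_nhds)
    gcongr
    exact (hG k).bound x
  exact tendsto_nhds_unique t1 (t2.neg.congr fun k => (hid k).symm)

end FracBV

end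

/-! ### Existence of the fractional variation measure -/

noncomputable section

namespace FracBV

open Filter Topology CompactlySupported

variable {n : ℕ}

/-- The space `C_c^∞(ℝⁿ; ℝⁿ)`. -/
def testFields (n : ℕ) : Submodule ℝ (Rn n → Rn n) where
  carrier := {φ | IsTestField φ}
  add_mem' h₁ h₂ := ⟨h₁.1.add h₂.1, h₁.2.add h₂.2⟩
  zero_mem' := ⟨contDiff_const, HasCompactSupport.zero⟩
  smul_mem' c _ h := ⟨h.1.const_smul c, h.2.smul_left (f := fun _ => c)⟩

/-- The space `C_c^∞(ℝⁿ)` as a subspace of `C_c(ℝⁿ)`. -/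
def testFunctions (n : ℕ) : Submodule ℝ C_c(Rn n, ℝ) where
  carrier := {g | ContDiff ℝ ∞ g}
  add_mem' {g h} (h₁ : ContDiff ℝ ∞ g) (h₂ : ContDiff ℝ ∞ h) := h₁.add h₂
  zero_mem' := (contDiff_const : ContDiff ℝ ∞ fun _ : Rn n => (0 : ℝ))
  smul_mem' c g (h : ContDiff ℝ ∞ g) := h.const_smul c

/-- The test field `g e_i`. -/
def coordField (i : Fin n) : testFunctions n →ₗ[ℝ] testFields n where
  toFun g := ⟨fun x => (g : C_c(Rn n, ℝ)) x • EuclideanSpace.single i 1,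
    ContDiff.smul (show ContDiff ℝ ∞ (g : C_c(Rn n, ℝ)) from g.2) contDiff_const, (g : C_c(Rn n, ℝ)).hasCompactSupport.smul_right⟩
  map_add' g h := by ext1; funext x; exact add_smul _ _ _
  map_smul' c g := by ext1; funext x; exact mul_smul _ _ _

section

variable (hn : 1 ≤ n) {α : ℝ} (hα : α ∈ Set.Ioo (0 : ℝ) 1) {p : ENNReal} (hp : 1 ≤ p)
  {f : Rn n → ℝ} (hf : MemLp f p)

/-- The linear functional `φ ↦ ∫ f div^α φ` on test fields. -/
def fracFunctional : testFields n →ₗ[ℝ] ℝ where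
  toFun φ := ∫ x, f x * fracDiv α φ.1 x
  map_add' φ ψ := by
    obtain ⟨L, M, R, hL, hR, hφ⟩ := φ.2.exists_isLipBump
    obtain ⟨L', M', R', hL', hR', hψ⟩ := ψ.2.exists_isLipBump
    rw [← integral_add (hφ.integrable_mul_fracDiv hn hα hp hf hL hR)
      (hψ.integrable_mul_fracDiv hn hα hp hf hL' hR')]
    congr with x
    rw [← mul_add, fracDiv_eq, fracDiv_eq, fracDiv_eq, ← mul_add,
      ← integral_add (hφ.integrable_fracDivKernel hn hα hL hR x)
        (hψ.integrable_fracDivKernel hn hα hL' hR' x)]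
    congr with y
    simp only [fracDivKernel, Submodule.coe_add, Pi.add_apply]
    rw [← add_div, ← inner_add_right]
    congr 2
    abel
  map_smul' c φ := by
    rw [RingHom.id_apply, smul_eq_mul, ← integral_const_mul]
    congr with x
    have : ∫ y, fracDivKernel α (c • φ : testFields n).1 x y =
        c * ∫ y, fracDivKernel α φ.1 x y := by
      rw [← integral_const_mul]
      congr with y
      simp only [fracDivKernel, Submodule.coe_smul, Pi.smul_apply]
      rw [← smul_sub, real_inner_smul_right, mul_div_assoc]
    rw [fracDiv_eq, fracDiv_eq, this]
    ring

theorem exists_bound_of_totalFracVariation_lt_top (h : totalFracVariation α f < ⊤) :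
    ∃ C : ℝ, ∀ φ, IsTestField φ → (∀ x, ‖φ x‖ ≤ 1) → ∫ x, f x * fracDiv α φ x ≤ C := by
  refine ⟨(totalFracVariation α f).toReal, fun φ hφ h1 => ?_⟩
  have hle : ((∫ x, f x * fracDiv α φ x : ℝ) : EReal) ≤ totalFracVariation α f :=
    le_iSup₂_of_le φ ⟨hφ, h1⟩ le_rfl
  exact EReal.coe_le_coe_iff.1 (hle.trans (EReal.le_coe_toReal h.ne))

include hn hα hp hf in
theorem exists_isFracVariationMeasure (h : totalFracVariation α f < ⊤) :
    ∃ (m : Measure (Rn n)) (u : Rn n → Rn n), Integrable u m ∧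
      IsFracVariationMeasure α f (m.withDensityᵥ u) := by
  obtain ⟨C, hC⟩ := exists_bound_of_totalFracVariation_lt_top h
  set Λ := fracFunctional hn hα hp hf
  have hC' : ∀ φ : testFields n, (∀ x, ‖φ.1 x‖ ≤ 1) → Λ φ ≤ C := fun φ hφ => hC φ.1 φ.2 hφ
  have hC0 : 0 ≤ C := by simpa using hC' 0 (by simp)
  have hbound : ∀ (i : Fin n) (g : testFunctions n) (c : ℝ), 0 ≤ c →
      (∀ x, |(g : C_c(Rn n, ℝ)) x| ≤ c) → (-(Λ ∘ₗ coordField i)) g ≤ C * c := by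
    intro i g c hc hg
    rcases hc.eq_or_lt with rfl | hc
    · have : g = 0 := by
        ext x
        simpa using hg x
      simp [this]
    -- Dividing by `c` normalises the field; the minus sign matches that of the functional.
    · have h1 := hC' (coordField i ((-c⁻¹) • g)) fun x => by
        change ‖((-c⁻¹) * (g : C_c(Rn n, ℝ)) x) • EuclideanSpace.single i (1 : ℝ)‖ ≤ 1
        rw [norm_smul, PiLp.norm_single, norm_one, mul_one, norm_mul, norm_neg, norm_inv,
          Real.norm_of_nonneg hc.le, Real.norm_eq_abs, inv_mul_le_one₀ hc]
        exact hg x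
      rw [map_smul, map_smul, smul_eq_mul] at h1
      rw [LinearMap.neg_apply, LinearMap.comp_apply]
      have h2 := mul_le_mul_of_nonneg_right h1 hc.le
      field_simp at h2
      linarith
  choose P N hP hN hPN using fun i =>
    exists_measures_of_bounded_functional (testFunctions n) (-(Λ ∘ₗ coordField i)) hC0 (hbound i)
  obtain ⟨m, u, hm, hu, hmu⟩ := exists_density_of_measures P N
  refine ⟨m, u, hu, ?_, fun φ hφ => ?_⟩
  · exact (isFiniteMeasure_variation_withDensityᵥ hu).1
  obtain ⟨B, hB⟩ := hφ.bounded
  rw [integral_withDensityᵥ_eq hu (innerSL ℝ) hφ.1.continuous.stronglyMeasurable hB]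
  let g : Fin n → testFunctions n := fun i =>
    ⟨⟨⟨fun x => φ x i, by have := hφ.1.continuous; fun_prop⟩,
      hφ.2.comp_left (g := fun v : Rn n => v i) rfl⟩,
      (contDiff_piLp_apply (𝕜 := ℝ) (p := 2) (E := fun _ : Fin n => ℝ) (i := i)).comp hφ.1⟩
  have hφg : (⟨φ, hφ⟩ : testFields n) = ∑ i, coordField i (g i) := by
    ext1
    funext x
    rw [Submodule.coe_sum, Finset.sum_apply]
    refine (EuclideanSpace.basisFun (Fin n) ℝ).sum_repr (φ x) |>.symm.trans ?_
    refine Finset.sum_congr rfl fun i _ => ?_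
    rw [EuclideanSpace.basisFun_repr, EuclideanSpace.basisFun_apply]
    rfl
  have hgi : ∀ i, ∀ ν : Measure (Rn n), IsFiniteMeasure ν → Integrable (fun x => φ x i) ν :=
    fun i ν _ => (g i).1.continuous.integrable_of_hasCompactSupport (g i).1.hasCompactSupport
  have hΛ : ∫ x, f x * fracDiv α φ x = ∑ i, Λ (coordField i (g i)) := by
    rw [← map_sum, ← hφg]
    rfl
  have hint : ∫ x, innerSL ℝ (φ x) (u x) ∂m = ∑ i, ∫ x, φ x i * u x i ∂m := by
    rw [← integral_finsetSum _ fun i _ => (hmu i _ (hgi i _ (hP i)) (hgi i _ (hN i))).1]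
    congr with x
    rw [innerSL_apply_apply, PiLp.inner_apply]
    exact Finset.sum_congr rfl fun i _ => mul_comm _ _
  rw [hΛ, hint, ← Finset.sum_neg_distrib]
  refine Finset.sum_congr rfl fun i _ => ?_
  rw [(hmu i _ (hgi i _ (hP i)) (hgi i _ (hN i))).2]
  have := hPN i (g i)
  rw [LinearMap.neg_apply, LinearMap.comp_apply] at this
  exact (neg_eq_iff_eq_neg.1 this)

end

/-- This converse to existence yields the membership of `f η`: its representing measure is exhibited
explicitly. -/
theorem totalFracVariation_lt_top {α : ℝ} {f : Rn n → ℝ} {μ : VectorMeasure (Rn n) (Rn n)}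
    (hμ : IsFracVariationMeasure α f μ) : totalFracVariation α f < ⊤ := by
  have : IsFiniteMeasure μ.variation := ⟨hμ.1⟩
  refine lt_of_le_of_lt (iSup₂_le fun φ hφ => ?_)
    (EReal.coe_lt_top (‖innerSL (E := Rn n) ℝ‖ * ∫ _, 1 ∂μ.variation))
  rw [EReal.coe_le_coe_iff, hμ.2 φ hφ.1]
  have h := VectorMeasure.norm_integral_le_integral_norm (μ := μ) (f := φ) (B := innerSL ℝ)
  refine (neg_le_abs _).trans (h.trans ?_)
  gcongr
  · exact hφ.1.1.continuous.norm.integrable_of_hasCompactSupport hφ.1.2.norm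
  · exact integrable_const 1
  · exact fun x => hφ.2 x

end FracBV

end

/-! ### The Leibniz rule -/

noncomputable section

namespace FracBV

variable {n : ℕ}

theorem IsLipBump.smul {L M R L' M' R' : ℝ} (hL : 0 ≤ L) {η : Rn n → ℝ} (hη : IsLipBump L M R η)
    {φ : Rn n → Rn n} (hφ : IsLipBump L' M' R' φ) :
    IsLipBump (M * L' + L * M') (M * M') R fun x => η x • φ x where
  lip x y := by
    have hM : 0 ≤ M := (norm_nonneg _).trans (hη.bound 0)
    calc ‖η y • φ y - η x • φ x‖ = ‖η y • (φ y - φ x) + (η y - η x) • φ x‖ := by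
          rw [smul_sub, sub_smul]; congr 1; abel
      _ ≤ M * (L' * ‖y - x‖) + L * ‖y - x‖ * M' := by
          refine (norm_add_le _ _).trans ?_
          rw [norm_smul, norm_smul]
          exact add_le_add (mul_le_mul (hη.bound y) (hφ.lip x y) (norm_nonneg _) hM)
            (mul_le_mul (hη.lip x y) (hφ.bound x) (norm_nonneg _) (by positivity))
      _ = _ := by ring
  bound x := by
    rw [norm_smul]
    exact mul_le_mul (hη.bound x) (hφ.bound x) (norm_nonneg _)
      ((norm_nonneg _).trans (hη.bound x))
  eq_zero x hx := by rw [hη.eq_zero x hx, zero_smul]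

theorem fracGradKernel_symm (α : ℝ) (g : Rn n → ℝ) (x y : Rn n) :
    fracGradKernel α g y x = fracGradKernel α g x y := by
  rw [fracGradKernel, fracGradKernel, norm_sub_rev x y, ← neg_sub (g y), ← neg_sub y x, smul_neg,
    neg_div, neg_smul, neg_neg]

theorem fracGradNLKernel_eq (α : ℝ) (f g : Rn n → ℝ) (x y : Rn n) :
    fracGradNLKernel α f g x y = f y • fracGradKernel α g x y - f x • fracGradKernel α g x y := by
  rw [fracGradNLKernel, fracGradKernel, mul_div_assoc, mul_smul, sub_smul]

/-- The last term carries `φ y` rather than `φ x`; after the exchange of variables the increment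
falls on `f`. -/
theorem fracDivKernel_smul (α : ℝ) (η : Rn n → ℝ) (φ : Rn n → Rn n) (x y : Rn n) :
    fracDivKernel α (fun x => η x • φ x) x y =
      η x * fracDivKernel α φ x y + inner ℝ (φ y) (fracGradKernel α η x y) := by
  have h : η y • φ y - η x • φ x = η x • (φ y - φ x) + (η y - η x) • φ y := by
    rw [smul_sub, sub_smul]; abel
  rw [fracDivKernel, fracDivKernel, fracGradKernel, h, inner_add_right, real_inner_smul_right,
    real_inner_smul_right, real_inner_smul_right, real_inner_comm (φ y)]
  ring

theorem measurable_fracGradKernel (α : ℝ) {g : Rn n → ℝ} (hg : Continuous g) :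
    Measurable fun q : Rn n × Rn n => fracGradKernel α g q.1 q.2 := by
  have h : Continuous fun q : Rn n × Rn n => g q.2 - g q.1 := by fun_prop
  exact (h.measurable.div (measurable_norm_sub_rpow _)).smul (measurable_snd.sub measurable_fst)

theorem IsLipBump.norm_fracGradKernel_le {α L M R : ℝ} (hα : 0 < α) (hL : 0 ≤ L) (hR : 0 ≤ R)
    {g : Rn n → ℝ} (hg : IsLipBump L M R g) (x y : Rn n) :
    ‖fracGradKernel α g x y‖ ≤ bumpConst n α L M R * (decay n α x * pairWeight n α R x y) :=
  (norm_div_smul hα _ _).le.trans (hg.quotient_le hα hL hR x y)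

theorem IsLipBump.integrable_fracGradKernel (hn : 1 ≤ n) {α : ℝ} (hα : α ∈ Set.Ioo (0 : ℝ) 1)
    {L M R : ℝ} (hL : 0 ≤ L) (hR : 0 ≤ R) {g : Rn n → ℝ} (hg : IsLipBump L M R g) (x : Rn n) :
    Integrable (fracGradKernel α g x) :=
  (((integrable_pairWeight hn hα R x).const_mul (decay n α x)).const_mul _).mono'
    ((measurable_fracGradKernel α (hg.continuous hL)).comp
      measurable_prodMk_left).aestronglyMeasurable
    (.of_forall fun y => hg.norm_fracGradKernel_le hα.1 hL hR x y)

theorem IsLipBump.memLp_mul {L M R : ℝ} (hL : 0 ≤ L) {η : Rn n → ℝ} (hη : IsLipBump L M R η)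
    {p q : ENNReal} {f : Rn n → ℝ} (hf : MemLp f p) (hqp : q ≤ p) :
    MemLp (fun x => f x * η x) q := by
  have h : MemLp (fun x => f x * η x) p := by
    refine hf.of_le_mul (c := M) (hf.1.mul (hη.continuous hL).aestronglyMeasurable)
      (.of_forall fun x => ?_)
    rw [norm_mul, mul_comm]
    gcongr
    exact hη.bound x
  refine h.mono_exponent_of_measure_support_ne_top (s := Metric.closedBall 0 R) (fun x hx => ?_)
    measure_closedBall_lt_top.ne hqp
  rw [hη.eq_zero x (by simpa using hx), mul_zero]

theorem integrable_inner_of_bound {Y : Type*} [MeasurableSpace Y] {m : Measure Y} {u : Y → Rn n}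
    (hu : Integrable u m) {ψ : Y → Rn n} (hψ : StronglyMeasurable ψ) {C : ℝ}
    (hC : ∀ y, ‖ψ y‖ ≤ C) : Integrable (fun y => inner ℝ (ψ y) (u y)) m :=
  integrable_bilin hu (innerSL ℝ) hψ hC

theorem integral_withDensityᵥ_innerSL {m : Measure (Rn n)} {u : Rn n → Rn n} (hu : Integrable u m)
    {φ : Rn n → Rn n} (hφ : StronglyMeasurable φ) {C : ℝ} (hC : ∀ x, ‖φ x‖ ≤ C) :
    (m.withDensityᵥ u).integral φ (innerSL ℝ) = ∫ x, inner ℝ (φ x) (u x) ∂m :=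
  integral_withDensityᵥ_eq hu (innerSL ℝ) hφ hC

section

variable (hn : 1 ≤ n) {α : ℝ} (hα : α ∈ Set.Ioo (0 : ℝ) 1) {p : ENNReal} (hp : 1 ≤ p)
  {f : Rn n → ℝ} (hf : MemLp f p) {L M R : ℝ} (hL : 0 ≤ L) (hR : 0 ≤ R)
  {η : Rn n → ℝ} (hη : IsLipBump L M R η)

include hn hα hp hf hL hR hη

theorem IsLipBump.integrable_smul_fracGradKernel :
    Integrable (fun q : Rn n × Rn n => f q.1 • fracGradKernel α η q.1 q.2)
      (volume.prod volume) := by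
  refine integrable_prod_of_le (C := bumpConst n α L M R) (R := R) hn hα hp hf
    ((aestronglyMeasurable_fst hf).smul
      (measurable_fracGradKernel α (hη.continuous hL)).aestronglyMeasurable) fun x y => ?_
  rw [norm_smul, Real.norm_eq_abs, mul_left_comm]
  gcongr
  exact hη.norm_fracGradKernel_le hα.1 hL hR x y

/-- The estimates weight only the first variable; symmetry of the kernel transfers them to the
second. -/
theorem IsLipBump.integrable_smul_fracGradKernel_snd :
    Integrable (fun q : Rn n × Rn n => f q.2 • fracGradKernel α η q.1 q.2)
      (volume.prod volume) := by
  refine (hη.integrable_smul_fracGradKernel hn hα hp hf hL hR).swap.congr (.of_forall fun q => ?_)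
  simp only [Function.comp_apply, Prod.fst_swap, Prod.snd_swap, fracGradKernel_symm α η q.1 q.2]

theorem IsLipBump.integrable_fracGradNLKernel_prod :
    Integrable (fun q : Rn n × Rn n => fracGradNLKernel α f η q.1 q.2) (volume.prod volume) := by
  simp_rw [fracGradNLKernel_eq]
  exact (hη.integrable_smul_fracGradKernel_snd hn hα hp hf hL hR).sub
    (hη.integrable_smul_fracGradKernel hn hα hp hf hL hR)

theorem IsLipBump.integrable_smul_fracGrad : Integrable fun x => f x • fracGrad α η x := by
  refine ((hη.integrable_smul_fracGradKernel hn hα hp hf hL hR).integral_prod_left.smul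
    (fracConst n α)).congr (.of_forall fun x => ?_)
  simp only [Pi.smul_apply, integral_smul, fracGrad]
  rw [smul_comm]

theorem IsLipBump.integrable_fracGradNLKernel :
    ∀ᵐ x, Integrable (fracGradNLKernel α f η x) :=
  (hη.integrable_fracGradNLKernel_prod hn hα hp hf hL hR).prod_right_ae

theorem IsLipBump.integrable_fracGradNL : Integrable (fracGradNL α f η) :=
  (hη.integrable_fracGradNLKernel_prod hn hα hp hf hL hR).integral_prod_left.smul (fracConst n α)

/-- The nonlocal Leibniz rule for the fractional divergence, integrated against `f`. -/
theorem IsLipBump.integral_fracDiv_smul {L' M' R' : ℝ} (hL' : 0 ≤ L') (hR' : 0 ≤ R')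
    {φ : Rn n → Rn n} (hφ : IsLipBump L' M' R' φ) :
    ∫ x, f x * fracDiv α (fun x => η x • φ x) x =
      (∫ x, f x * η x * fracDiv α φ x) + (∫ x, inner ℝ (φ x) (f x • fracGrad α η x)) +
        ∫ x, inner ℝ (φ x) (fracGradNL α f η x) := by
  have hM : 0 ≤ M := (norm_nonneg _).trans (hη.bound 0)
  have hM' : 0 ≤ M' := (norm_nonneg _).trans (hφ.bound 0)
  have hφc := hφ.continuous hL'
  have iA := hη.integrable_smul_fracGradKernel hn hα hp hf hL hR
  have iN := hη.integrable_fracGradNLKernel_prod hn hα hp hf hL hR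
  have hfη := hη.memLp_mul hL hf le_rfl
  have hfst : StronglyMeasurable fun q : Rn n × Rn n => φ q.1 :=
    (hφc.comp continuous_fst).stronglyMeasurable
  have hsnd : StronglyMeasurable fun q : Rn n × Rn n => φ q.2 :=
    (hφc.comp continuous_snd).stronglyMeasurable
  have jA := integrable_inner_of_bound iA hfst fun q => hφ.bound q.1
  have jA' := integrable_inner_of_bound iA hsnd fun q => hφ.bound q.2
  have jN := integrable_inner_of_bound iN hfst fun q => hφ.bound q.1
  have e1 : ∫ q : Rn n × Rn n, f q.1 * fracDivKernel α (fun x => η x • φ x) q.1 q.2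
        ∂(volume.prod volume) =
      (∫ q : Rn n × Rn n, f q.1 * η q.1 * fracDivKernel α φ q.1 q.2 ∂(volume.prod volume)) +
      ∫ q : Rn n × Rn n, inner ℝ (φ q.2) (f q.1 • fracGradKernel α η q.1 q.2)
        ∂(volume.prod volume) := by
    rw [← integral_add (hφ.integrable_mul_fracDivKernel hn hα hp hfη hL' hR') jA']
    congr with q
    rw [fracDivKernel_smul, real_inner_smul_right]
    ring
  -- After the swap the factor is `f(y) = f(x) + (f(y) - f(x))`, whose parts give the local and the
  -- non-local term.
  have e2 : ∫ q : Rn n × Rn n, inner ℝ (φ q.2) (f q.1 • fracGradKernel α η q.1 q.2)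
        ∂(volume.prod volume) =
      (∫ q : Rn n × Rn n, inner ℝ (φ q.1) (f q.1 • fracGradKernel α η q.1 q.2)
        ∂(volume.prod volume)) +
      ∫ q : Rn n × Rn n, inner ℝ (φ q.1) (fracGradNLKernel α f η q.1 q.2)
        ∂(volume.prod volume) := by
    rw [← integral_add jA jN, ← integral_prod_swap]
    congr with q
    simp only [Prod.fst_swap, Prod.snd_swap, fracGradKernel_symm α η q.1 q.2]
    rw [← inner_add_right, fracGradNLKernel_eq]
    congr 1
    abel
  have e3 : fracConst n α * ∫ q : Rn n × Rn n, inner ℝ (φ q.1) (f q.1 • fracGradKernel α η q.1 q.2)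
        ∂(volume.prod volume) = ∫ x, inner ℝ (φ x) (f x • fracGrad α η x) := by
    rw [integral_prod _ jA, ← integral_const_mul]
    congr with x
    have h := integral_inner (𝕜 := ℝ) ((hη.integrable_fracGradKernel hn hα hL hR x).smul (f x)) (φ x)
    simp only [Pi.smul_apply, integral_smul] at h ⊢
    rw [h, fracGrad, ← real_inner_smul_right, smul_comm]
  have e4 : fracConst n α * ∫ q : Rn n × Rn n, inner ℝ (φ q.1) (fracGradNLKernel α f η q.1 q.2)
        ∂(volume.prod volume) = ∫ x, inner ℝ (φ x) (fracGradNL α f η x) := by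
    rw [integral_prod _ jN, ← integral_const_mul]
    refine integral_congr_ae ?_
    filter_upwards [hη.integrable_fracGradNLKernel hn hα hp hf hL hR] with x hx
    rw [integral_inner hx, fracGradNL, real_inner_smul_right]
  rw [(hη.smul hL hφ).integral_mul_fracDiv hn hα hp hf (by positivity) hR,
    hφ.integral_mul_fracDiv hn hα hp hfη hL' hR', e1, e2, mul_add, mul_add, e3, e4, add_assoc]

/-- The Leibniz rule at the level of measures with densities. -/
theorem IsFracVariationMeasure.mul_lipBump {m : Measure (Rn n)} {h : Rn n → Rn n}
    (hh : Integrable h m) (hμ : IsFracVariationMeasure α f (m.withDensityᵥ h)) :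
    IsFracVariationMeasure α (fun x => f x * η x)
      (m.withDensityᵥ (fun x => η x • h x) + volume.withDensityᵥ (fun x => f x • fracGrad α η x) +
        volume.withDensityᵥ (fracGradNL α f η)) := by
  have hηc := hη.continuous hL
  have hηh : Integrable (fun x => η x • h x) m :=
    integrable_bilin hh (ContinuousLinearMap.lsmul ℝ ℝ) hηc.stronglyMeasurable hη.bound
  have i1 := hη.integrable_smul_fracGrad hn hα hp hf hL hR
  have i2 := hη.integrable_fracGradNL hn hα hp hf hL hR
  have := isFiniteMeasure_variation_withDensityᵥ hηh
  have := isFiniteMeasure_variation_withDensityᵥ i1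
  have := isFiniteMeasure_variation_withDensityᵥ i2
  have hfin := isFiniteMeasure_of_le _ (VectorMeasure.variation_add_le
    (μ := m.withDensityᵥ (fun x => η x • h x))
    (ν := volume.withDensityᵥ (fun x => f x • fracGrad α η x)))
  have hfin' := isFiniteMeasure_of_le _ (VectorMeasure.variation_add_le
    (μ := m.withDensityᵥ (fun x => η x • h x) +
      volume.withDensityᵥ (fun x => f x • fracGrad α η x))
    (ν := volume.withDensityᵥ (fracGradNL α f η)))
  refine ⟨hfin'.1, fun φ hφ => ?_⟩
  obtain ⟨L', M', R', hL', hR', hφb⟩ := hφ.exists_isLipBump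
  have hi : ∀ ν : Measure (Rn n), IsFiniteMeasure ν → Integrable φ ν := fun ν _ =>
    hφ.1.continuous.integrable_of_hasCompactSupport hφ.2
  have hM : 0 ≤ M := (norm_nonneg _).trans (hη.bound 0)
  have hM' : 0 ≤ M' := (norm_nonneg _).trans (hφb.bound 0)
  have hφm := hφ.1.continuous.stronglyMeasurable
  rw [VectorMeasure.integral_add_vectorMeasure (hi _ inferInstance) (hi _ inferInstance),
    VectorMeasure.integral_add_vectorMeasure (hi _ inferInstance) (hi _ inferInstance),
    integral_withDensityᵥ_innerSL hηh hφm hφb.bound,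
    integral_withDensityᵥ_innerSL i1 hφm hφb.bound,
    integral_withDensityᵥ_innerSL i2 hφm hφb.bound]
  have key := hη.integral_fracDiv_smul hn hα hp hf hL hR hL' hR' hφb
  -- The identity for `D^α f` is tested on `η φ`, which is Lipschitz but need not be smooth.
  rw [hμ.integral_lipBump hn hα hp hf hh (by positivity) hR (hη.smul hL hφb)] at key
  have e : ∀ x, inner ℝ (η x • φ x) (h x) = inner ℝ (φ x) (η x • h x) := fun x => by
    rw [real_inner_smul_left, real_inner_smul_right]
  simp_rw [e] at key
  rw [neg_eq_iff_eq_neg] at key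
  linarith

end

end FracBV

end
-- Assembly of the theorem
open FracBV in
theorem mainTheorem10 (n : ℕ) (hn : 1 ≤ n) (α : ℝ) (hα : α ∈ Set.Ioo (0 : ℝ) 1)
    (p : ENNReal) (hp : 1 ≤ p) (f : Rn n → ℝ) (hf : MemBV α p f)
    (η : Rn n → ℝ) (hη : ∃ K : NNReal, LipschitzWith K η) (hηc : HasCompactSupport η) :
    -- `f η ∈ BV^{α,q}` for all `q ∈ [1,p]`
    (∀ q : ENNReal, 1 ≤ q → q ≤ p → MemBV α q (fun x => f x * η x)) ∧
    -- `D^α f` and `D^α (f η)` are genuine fractional variation measures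
    IsFracVariationMeasure α f (fracVariation α f) ∧
    IsFracVariationMeasure α (fun x => f x * η x) (fracVariation α (fun x => f x * η x)) ∧
    -- the three terms on the right-hand side are well defined
    (fracVariation α f).Integrable η ∧
    (∀ x, Integrable (fracGradKernel α η x)) ∧
    Integrable (fun x => f x • fracGrad α η x) ∧
    (∀ᵐ x, Integrable (fracGradNLKernel α f η x)) ∧
    Integrable (fracGradNL α f η) ∧
    -- the Leibniz rule, as an identity of finite vector measures
    fracVariation α (fun x => f x * η x) =
      (fracVariation α f).withDensity η (ContinuousLinearMap.lsmul ℝ ℝ) +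
        volume.withDensityᵥ (fun x => f x • fracGrad α η x) +
        volume.withDensityᵥ (fracGradNL α f η) := by
  obtain ⟨L, M, R, hL, hR, hb⟩ := exists_isLipBump hη hηc
  obtain ⟨m, h, hh, hμ⟩ := exists_isFracVariationMeasure hn hα hp hf.1 hf.2
  have hν := hμ.mul_lipBump hn hα hp hf.1 hL hR hb hh
  have hηs := (hb.continuous hL).stronglyMeasurable
  have hfin := isFiniteMeasure_variation_withDensityᵥ hh
  -- Uniqueness replaces the chosen measures by the explicit densities, after which the Leibniz rule
  -- is definitional.
  rw [fracVariation_eq hμ, fracVariation_eq hν, withDensity_withDensityᵥ hh hηs hb.bound]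
  exact ⟨fun q _ hq => ⟨hb.memLp_mul hL hf.1 hq, totalFracVariation_lt_top hν⟩, hμ, hν,
    Integrable.of_bound hηs.aestronglyMeasurable M (.of_forall hb.bound),
    hb.integrable_fracGradKernel hn hα hL hR, hb.integrable_smul_fracGrad hn hα hp hf.1 hL hR,
    hb.integrable_fracGradNLKernel hn hα hp hf.1 hL hR,
    hb.integrable_fracGradNL hn hα hp hf.1 hL hR, rfl⟩
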